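/- Let $d\ge 2$, $\omega=e^{2\pi i/d}$, and let $(L,\mathcal M,\epsilon)$ be a signed arrangement: $L$ is a finite set, $\mathcal M$ is a collection of subsets of $L$ (contexts), each context $C$ being given with an ordering $a_1,\dots,a_k$ of its elements, and $\epsilon\colon L\to\{\pm1\}$. For $\tau\colon\mathcal M\to\mathbb Z/d$, an operator realization of $\tau$ is a map $T\colon L\to U(n)$, for some $n\ge 1$, such that $(T_a)^d=I$ for all $a\in L$ and $T_{a_1}^{\epsilon(a_1)}\cdots T_{a_k}^{\epsilon(a_k)}=\omega^{\tau(C)}I$ for every context $C=\{a_1,\dots,a_k\}$; a classical realization of $\tau$ is a map $c\colon L\to\mathbb Z/d$ such that $\prod_{a\in C}\omega^{\epsilon(a)c(a)}=\omega^{\tau(C)}$ for every context $C$. Call $\tau$ operator (respectively classically) realizable if it has an operator (respectively classical) realization. Let $X_{\mathrm{sing}}$ be the cell complex with one vertex, one edge (a loop) for each $a\in L$, and one $2$-cell for each $C\in\mathcal M$, attached along the loop $a_1^{\epsilon(a_1)}\cdots a_k^{\epsilon(a_k)}$ (the constant loop if $C=\emptyset$). A topological realization of $(L,\mathcal M,\epsilon)$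 is a connected cell complex $X$ of dimension at most $2$ together with a map of cell complexes $X\to X_{\mathrm{sing}}$ (continuous, sending vertices to the vertex and carrying each closed $1$-cell and $2$-cell to a cell of $X_{\mathrm{sing}}$ through a homeomorphism of (closed ball, boundary sphere) between the domains of the characteristic maps) that induces bijections on the sets of $1$-cells and of $2$-cells. Suppose that $(L,\mathcal M,\epsilon)$ has a topological realization $X$ whose fundamental group $\pi_1(X)$ is finite of order coprime to $d$. Then every operator realizable $\tau\colon\mathcal M\to\mathbb Z/d$ is classically realizable. -/

import Mathlib

/-- A signed arrangement on a label set `L`: a collection of contexts (subsets of `L`), an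
enumeration `a₁, …, a_k` (without repetition) of the elements of every context, fixing the order of
the factors in the operator constraints, and a sign function `ε : L → {±1}`. -/
structure SignedArrangement (L : Type*) where
  /-- The collection of contexts. -/
  contexts : Set (Finset L)
  /-- The chosen enumeration of the elements of a context. -/
  word : contexts → List L
  word_nodup : ∀ C, (word C).Nodup
  mem_word : ∀ C a, a ∈ word C ↔ a ∈ C.1
  /-- The sign function `ε`. -/
  sign : L → ℤˣ

namespace SignedArrangement

/-- `ω ^ k` for `k ∈ ℤ/d`, where `ω = exp (2πi / d)`. -/
noncomputable def omegaPow (d : ℕ) (k : ZMod d) : ℂ :=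
  Complex.exp (2 * Real.pi * Complex.I / d) ^ k.val

variable {L : Type*} (A : SignedArrangement L)

/-- `T : L → U(n)` is an operator realization of `(L, M, ε, τ)`: `(T_a) ^ d = I` for every label,
and `T_{a₁} ^ ε(a₁) ⋯ T_{a_k} ^ ε(a_k) = ω ^ τ(C) I` for every context `C = {a₁, …, a_k}`. -/
def IsOperatorRealization (d : ℕ) (τ : A.contexts → ZMod d) {n : ℕ}
    (T : L → Matrix.unitaryGroup (Fin n) ℂ) : Prop :=
  (∀ a, T a ^ d = 1) ∧
  ∀ C : A.contexts,
    ((((A.word C).map fun a => T a ^ (A.sign a : ℤ)).prod : Matrix.unitaryGroup (Fin n) ℂ) :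
      Matrix (Fin n) (Fin n) ℂ) = omegaPow d (τ C) • (1 : Matrix (Fin n) (Fin n) ℂ)

/-- `τ` has an operator realization on some space `ℂⁿ` with `n ≥ 1`. -/
def OperatorRealizable (d : ℕ) (τ : A.contexts → ZMod d) : Prop :=
  ∃ n : ℕ, 1 ≤ n ∧ ∃ T : L → Matrix.unitaryGroup (Fin n) ℂ, A.IsOperatorRealization d τ T

/-- `c : L → ℤ/d` is a classical realization of `(L, M, ε, τ)`: for every context `C`,
`∏_{a ∈ C} ω ^ (ε(a) c(a)) = ω ^ τ(C)`. -/
def IsClassicalRealization (d : ℕ) (τ : A.contexts → ZMod d) (c : L → ZMod d) : Prop :=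
  ∀ C : A.contexts,
    ∏ a ∈ C.1, omegaPow d (((A.sign a : ℤ) : ZMod d) * c a) = omegaPow d (τ C)

/-- `τ` has a classical realization. -/
def ClassicallyRealizable (d : ℕ) (τ : A.contexts → ZMod d) : Prop :=
  ∃ c : L → ZMod d, A.IsClassicalRealization d τ c

/-! ### The cell complex with a single vertex -/

/-- The disjoint union of a point, of an interval `[0, 1]` for every label, and of a closed disc
`{z ∈ ℂ : |z| ≤ 1}` for every context. -/
abbrev PreSing : Type _ :=
  PUnit.{1} ⊕ (Σ _ : L, unitInterval) ⊕ (Σ _ : A.contexts, Metric.closedBall (0 : ℂ) 1)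

/-- The point `exp (2πi s)` on the boundary of the unit disc. -/
noncomputable def bdryPoint (s : ℝ) : Metric.closedBall (0 : ℂ) 1 :=
  ⟨Circle.exp (2 * Real.pi * s), by
    rw [mem_closedBall_zero_iff]; exact (Circle.norm_coe _).le⟩

/-- The point with parameter `r` on the oriented edge `a ^ u`, `u = ±1`, as a parameter of `a`. -/
def orient (u : ℤˣ) (r : unitInterval) : unitInterval :=
  if u = 1 then r else unitInterval.symm r

/-- The gluing relation: both end points of every interval are glued to the point; the boundary
circle of the disc of a context with word `a₁ ⋯ a_k`, `k ≥ 1`, is divided into `k` equal arcs,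
starting at `1`, and the successive arcs are glued along `a₁ ^ ε(a₁), …, a_k ^ ε(a_k)`; the boundary
of the disc of an empty context is glued to the point. -/
inductive Glue : A.PreSing → A.PreSing → Prop
  | edge_zero (a : L) : Glue (.inr (.inl ⟨a, 0⟩)) (.inl .unit)
  | edge_one (a : L) : Glue (.inr (.inl ⟨a, 1⟩)) (.inl .unit)
  | face (C : A.contexts) (j : Fin (A.word C).length) (r : unitInterval) :
      Glue (.inr (.inr ⟨C, bdryPoint (((j : ℕ) + (r : ℝ)) / (A.word C).length)⟩))
        (.inr (.inl ⟨(A.word C).get j, orient (A.sign ((A.word C).get j)) r⟩))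
  | face_nil (C : A.contexts) (h : A.word C = []) (z : Metric.closedBall (0 : ℂ) 1)
      (hz : ‖(z : ℂ)‖ = 1) : Glue (.inr (.inr ⟨C, z⟩)) (.inl .unit)

/-- The cell complex with one vertex, one edge for every label and one face for every context, with
the quotient topology. -/
def XSing : Type _ := Quot A.Glue

instance : TopologicalSpace A.XSing := inferInstanceAs (TopologicalSpace (Quot A.Glue))

/-- The vertex of `XSing`. -/
def vertex : A.XSing := Quot.mk _ (.inl .unit)

/-- The characteristic map of the edge labeled by `a`. -/
def edgeMap (a : L) (t : unitInterval) : A.XSing := Quot.mk _ (.inr (.inl ⟨a, t⟩))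

/-- The characteristic map of the face labeled by `C`. -/
def faceMap (C : A.contexts) (z : Metric.closedBall (0 : ℂ) 1) : A.XSing :=
  Quot.mk _ (.inr (.inr ⟨C, z⟩))

open Topology.CWComplex in
/-- A topological realization of the signed arrangement `A` on the CW complex `X`: `X` is connected
and of dimension at most two, and there is a map of cell complexes `X → XSing` inducing bijections
on `1`-cells and on `2`-cells, i.e. a continuous map that sends `0`-cells to the vertex and maps
every closed `1`-cell (`2`-cell) of `X` to the corresponding one of `XSing` through a homeomorphism
of the pair (closed ball, boundary sphere); so the cells may be parametrized in any way. -/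
structure TopologicalRealization (X : Type*) [TopologicalSpace X]
    [Topology.CWComplex (Set.univ : Set X)] where
  connected : ConnectedSpace X
  dim_le_two : ∀ n, 2 < n → IsEmpty (cell (Set.univ : Set X) n)
  /-- The map of cell complexes `X → XSing`. -/
  toSing : C(X, A.XSing)
  /-- The bijection on `1`-cells. -/
  edgeEquiv : cell (Set.univ : Set X) 1 ≃ L
  /-- The bijection on `2`-cells. -/
  faceEquiv : cell (Set.univ : Set X) 2 ≃ A.contexts
  map_vertex : ∀ v : cell (Set.univ : Set X) 0, toSing (map 0 v 0) = A.vertex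
  map_edge : ∀ e : cell (Set.univ : Set X) 1,
    ∃ h : Metric.closedBall (0 : Fin 1 → ℝ) 1 ≃ₜ unitInterval,
      (∀ x, (h x = 0 ∨ h x = 1) ↔ (x : Fin 1 → ℝ) ∈ Metric.sphere 0 1) ∧
      ∀ x : Metric.closedBall (0 : Fin 1 → ℝ) 1, toSing (map 1 e x) = A.edgeMap (edgeEquiv e) (h x)
  map_face : ∀ f : cell (Set.univ : Set X) 2,
    ∃ h : Metric.closedBall (0 : Fin 2 → ℝ) 1 ≃ₜ Metric.closedBall (0 : ℂ) 1,
      (∀ x, (h x : ℂ) ∈ Metric.sphere 0 1 ↔ (x : Fin 2 → ℝ) ∈ Metric.sphere 0 1) ∧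
      ∀ x : Metric.closedBall (0 : Fin 2 → ℝ) 1, toSing (map 2 f x) = A.faceMap (faceEquiv f) (h x)

end SignedArrangement

/-! Modulo scalars, an operator realization labels the edges by `PU(n)` flatly: every context has
product `1`. A flat labeling defines a map from `XSing` to a classifying space, hence a homotopy
invariant holonomy of paths in `X`. Gauging by the holonomy of paths from a base point moves all
labels into the image of `π₁(X)`, a finite subgroup `H` (`exists_gauge`). Lifted to `U(n)`, the
gauged labels lie in a central extension of `H` by the circle. There the transfer is a power map,
with exponent `N` dividing `|H|`, and a homomorphism to the circle (`exists_pow_hom_of_central`). It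
turns the operators into scalars that realize `N τ`.

These scalars need not be `d`-th roots of unity, but their `d`-th powers are flat. With `m =
|π₁(X)|`, a second gauge makes those powers `m`-torsion; a `d`-th root of the `m`-th power of this
gauge then corrects the `m`-th powers of the scalars to `d`-th roots of unity realizing `N m τ`
(`exists_root_labeling`). Since `N m` is prime to `d`, it can be divided out. Gauges cancel on every
context because its edges form a closed walk in `X` (`exists_edge_paths`).

The classifying space is the quotient of `StepSpace G` by `G`: the action is free with separated
orbits, so the quotient map is a covering, and `splice` contracts the space, so lifted boundary
loops extend over faces. -/

open MeasureTheory Topology unitInterval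

/-! ### A contractible space with a free action of a discrete group -/

/-- The space of functions `[0, 1) → G`, in which the distance of two functions is the (outer)
Lebesgue measure of the set where they differ. -/
def StepSpace (G : Type*) : Type _ := Set.Ico (0 : ℝ) 1 → G

namespace StepSpace

variable {G : Type*}

/-- The set where two functions differ. -/
def diffSet (f g : StepSpace G) : Set ℝ := Subtype.val '' {x | f x ≠ g x}

theorem diffSet_subset_Ico (f g : StepSpace G) : diffSet f g ⊆ Set.Ico 0 1 := by
  rintro _ ⟨x, -, rfl⟩
  exact x.2

theorem volume_diffSet_ne_top (f g : StepSpace G) : volume (diffSet f g) ≠ ⊤ :=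
  ((measure_mono (diffSet_subset_Ico f g)).trans_lt (by simp)).ne

theorem diffSet_comm (f g : StepSpace G) : diffSet f g = diffSet g f := by
  simp only [diffSet, ne_comm]

theorem diffSet_subset_union (f g h : StepSpace G) :
    diffSet f h ⊆ diffSet f g ∪ diffSet g h := by
  rintro _ ⟨x, hx, rfl⟩
  by_cases hfg : f x = g x
  · exact Or.inr ⟨x, fun hgh => hx (hfg.trans hgh), rfl⟩
  · exact Or.inl ⟨x, hfg, rfl⟩

/-- Outer measure is monotone and subadditive on all sets, so no measurability is required of the
functions. -/
noncomputable instance : PseudoMetricSpace (StepSpace G) where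
  dist f g := (volume (diffSet f g)).toReal
  dist_self f := by simp [diffSet]
  dist_comm f g := by rw [diffSet_comm]
  dist_triangle f g h := by
    rw [← ENNReal.toReal_add (volume_diffSet_ne_top _ _) (volume_diffSet_ne_top _ _)]
    exact ENNReal.toReal_mono
      (ENNReal.add_ne_top.2 ⟨volume_diffSet_ne_top _ _, volume_diffSet_ne_top _ _⟩)
      ((measure_mono (diffSet_subset_union f g h)).trans (measure_union_le _ _))

theorem dist_def (f g : StepSpace G) : dist f g = (volume (diffSet f g)).toReal := rfl

variable [Group G]

instance : One (StepSpace G) := inferInstanceAs (One (Set.Ico (0 : ℝ) 1 → G))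

instance : MulAction G (StepSpace G) := inferInstanceAs (MulAction G (Set.Ico (0 : ℝ) 1 → G))

@[simp] theorem smul_apply (g : G) (f : StepSpace G) (x : Set.Ico (0 : ℝ) 1) :
    (g • f) x = g * f x := rfl

instance : IsIsometricSMul G (StepSpace G) where
  isometry_smul g := Isometry.of_dist_eq fun f h => by simp [dist_def, diffSet]

theorem dist_smul_self {g : G} (hg : g ≠ 1) (f : StepSpace G) : dist (g • f) f = 1 := by
  have : diffSet (g • f) f = Set.Ico 0 1 := by simp [diffSet, hg, Set.Ico_def]
  rw [dist_def, this, Real.volume_Ico]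
  simp

theorem eq_of_smul_eq_smul {g h : G} (f : StepSpace G) (hgh : g • f = h • f) : g = h := by
  simpa using congrFun hgh ⟨0, by simp⟩

/-- The function that agrees with `f` on `[0, s)` and is equal to `1` elsewhere. -/
noncomputable def splice (s : ℝ) (f : StepSpace G) : StepSpace G :=
  fun x => if (x : ℝ) < s then f x else 1

@[simp] theorem splice_zero (f : StepSpace G) : splice 0 f = 1 := by
  funext x
  exact if_neg x.2.1.not_gt

@[simp] theorem splice_one (f : StepSpace G) : splice 1 f = f := by
  funext x
  exact if_pos x.2.2

theorem dist_splice_left_le (s s' : ℝ) (f : StepSpace G) :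
    dist (splice s f) (splice s' f) ≤ dist s s' := by
  have h : diffSet (splice s f) (splice s' f) ⊆ Set.Ico (min s s') (max s s') := by
    rintro _ ⟨x, hx, rfl⟩
    by_contra hx'
    refine hx ?_
    simp only [Set.mem_Ico, min_le_iff, lt_max_iff, not_and_or, not_or, not_le, not_lt] at hx'
    rcases hx' with hx' | hx'
    · simp [splice, hx'.1, hx'.2]
    · simp [splice, hx'.1.not_gt, hx'.2.not_gt]
  calc dist (splice s f) (splice s' f)
      ≤ (volume (Set.Ico (min s s') (max s s'))).toReal :=
        ENNReal.toReal_mono (by simp) (measure_mono h)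
    _ = dist s s' := by
        rw [Real.volume_Ico, ENNReal.toReal_ofReal (sub_nonneg.2 min_le_max),
          max_sub_min_eq_abs', Real.dist_eq]

theorem dist_splice_right_le (s : ℝ) (f f' : StepSpace G) :
    dist (splice s f) (splice s f') ≤ dist f f' := by
  refine ENNReal.toReal_mono (volume_diffSet_ne_top _ _) (measure_mono ?_)
  rintro _ ⟨x, hx, rfl⟩
  refine ⟨x, fun h => hx ?_, rfl⟩
  simp [splice, h]

/-- As the first argument runs from `1` to `0`, this contracts the whole space to the constant
function `1`. -/
theorem continuous_splice : Continuous fun p : ℝ × StepSpace G => splice p.1 p.2 := by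
  refine (LipschitzWith.of_dist_le_mul (K := 2) fun p p' => ?_).continuous
  calc dist (splice p.1 p.2) (splice p'.1 p'.2)
      ≤ dist (splice p.1 p.2) (splice p'.1 p.2) + dist (splice p'.1 p.2) (splice p'.1 p'.2) :=
        dist_triangle _ _ _
    _ ≤ dist p.1 p'.1 + dist p.2 p'.2 :=
        add_le_add (dist_splice_left_le _ _ _) (dist_splice_right_le _ _ _)
    _ ≤ dist p p' + dist p p' := add_le_add (le_max_left _ _) (le_max_right _ _)
    _ = _ := by rw [← two_mul]; rfl

variable (G) in
/-- The quotient of `StepSpace G` by the action of `G`. -/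
abbrev Orbits : Type _ := MulAction.orbitRel.Quotient G (StepSpace G)

/-- The class of a function in the quotient. -/
def toOrbits (f : StepSpace G) : Orbits G := Quotient.mk _ f

theorem toOrbits_smul (g : G) (f : StepSpace G) : toOrbits (g • f) = toOrbits f :=
  Quotient.sound ⟨g, rfl⟩

theorem toOrbits_eq_iff {f f' : StepSpace G} : toOrbits f = toOrbits f' ↔ ∃ g : G, g • f' = f :=
  Quotient.eq''

theorem continuous_toOrbits : Continuous (toOrbits (G := G)) := continuous_quotient_mk'

theorem isQuotientCoveringMap_toOrbits : IsQuotientCoveringMap (toOrbits (G := G)) G where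
  __ := isQuotientMap_quotient_mk'
  continuous_const_smul g := (isometry_smul _ g).continuous
  apply_eq_iff_mem_orbit := Quotient.eq''
  disjoint f := by
    -- A nontrivial `g` moves every point by exactly `1`, so it cannot keep a point inside a ball of
    -- radius `1 / 2`.
    refine ⟨Metric.ball f (1 / 2), Metric.ball_mem_nhds _ (by norm_num), fun g hg => ?_⟩
    obtain ⟨_, ⟨h, hh, rfl⟩, hgh⟩ := hg
    by_contra hne
    have h1 := dist_smul_self hne h
    have h2 := dist_triangle_right (g • h) h f
    rw [Metric.mem_ball] at hh hgh
    simp only at hgh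
    linarith

end StepSpace

/-! ### Holonomy of paths -/

namespace StepSpace

variable {G : Type*} [Group G]

/-- A representative of every orbit, which is `1` for the orbit of `1`. -/
noncomputable def rep (b : Orbits G) : StepSpace G :=
  open Classical in if b = toOrbits 1 then 1 else Quotient.out b

-- This normalization makes the holonomy of an edge equal to its label, not merely conjugate to it.
@[simp] theorem rep_toOrbits_one : rep (toOrbits (1 : StepSpace G)) = 1 := if_pos rfl

@[simp] theorem toOrbits_rep (b : Orbits G) : toOrbits (rep b) = b := by
  unfold rep
  split_ifs with h
  · exact h.symm
  · exact Quotient.out_eq b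

theorem exists_smul_rep (f : StepSpace G) : ∃ g : G, g • rep (toOrbits f) = f := by
  simpa using toOrbits_eq_iff.1 (toOrbits_rep (toOrbits f)).symm

variable {X : Type*} [TopologicalSpace X] (c : C(X, Orbits G)) {x y z : X}

theorem exists_lift (p : Path x y) : ∃ (g : G) (Γ : Path (rep (c x)) (g • rep (c y))),
    ∀ r, toOrbits (Γ r) = c (p r) := by
  have cov := (isQuotientCoveringMap_toOrbits (G := G)).isCoveringMap
  obtain ⟨Γ, hΓ, hΓ0⟩ := cov.exists_path_lifts (c.comp p.toContinuousMap) (rep (c x)) (by simp)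
  obtain ⟨g, hg⟩ := exists_smul_rep (Γ 1)
  have h (r : I) : toOrbits (Γ r) = c (p r) := congrFun hΓ r
  rw [h, p.target] at hg
  exact ⟨g, ⟨Γ, hΓ0, hg.symm⟩, h⟩

/-- The holonomy of a path, the group element that compares the end points of its lift with the
chosen representatives. -/
noncomputable def holonomy (p : Path x y) : G := (exists_lift c p).choose

theorem exists_lift_holonomy (p : Path x y) :
    ∃ Γ : Path (rep (c x)) (holonomy c p • rep (c y)), ∀ r, toOrbits (Γ r) = c (p r) :=
  (exists_lift c p).choose_spec

/-- Uniqueness of lifts: `Γ` is the `g`-translate of the chosen lift. Thus any lift at hand computes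
the holonomy. -/
theorem smul_holonomy_eq_of_lift (p : Path x y) (Γ : C(I, StepSpace G))
    (hΓ : ∀ r, toOrbits (Γ r) = c (p r)) {g h : G} (h0 : Γ 0 = g • rep (c x))
    (h1 : Γ 1 = h • rep (c y)) : g * holonomy c p = h := by
  have cov := (isQuotientCoveringMap_toOrbits (G := G)).isCoveringMap
  obtain ⟨Λ, hΛ⟩ := exists_lift_holonomy c p
  have hcont : Continuous fun r => g • Λ r := Λ.continuous.const_smul g
  have key : ⇑Γ = fun r => g • Λ r :=
    cov.eq_of_comp_eq Γ.continuous hcont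
      (funext fun r => by simp [toOrbits_smul, hΓ, hΛ]) 0 (by simp [h0])
  refine eq_of_smul_eq_smul (rep (c y)) ?_
  calc (g * holonomy c p) • rep (c y) = g • Λ 1 := by rw [Λ.target, mul_smul]
    _ = h • rep (c y) := by rw [← h1, key]

theorem holonomy_trans (p : Path x y) (q : Path y z) :
    holonomy c (p.trans q) = holonomy c p * holonomy c q := by
  obtain ⟨Γ, hΓ⟩ := exists_lift_holonomy c p
  obtain ⟨Λ, hΛ⟩ := exists_lift_holonomy c q
  let Λ' : Path (holonomy c p • rep (c y)) (holonomy c p • holonomy c q • rep (c z)) :=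
    Λ.map (continuous_const_smul (holonomy c p))
  have hlift : ∀ r, toOrbits ((Path.trans Γ Λ') r) = c ((p.trans q) r) := by
    intro r
    rw [Path.trans_apply, Path.trans_apply]
    split_ifs
    · exact hΓ _
    · exact (toOrbits_smul _ _).trans (hΛ _)
  have := smul_holonomy_eq_of_lift c (p.trans q) (Path.trans Γ Λ').toContinuousMap hlift
    (g := 1) (h := holonomy c p * holonomy c q) (by simp) (by simp [mul_smul])
  simpa using this

theorem holonomy_eq_of_homotopic {p q : Path x y} (hpq : p.Homotopic q) :
    holonomy c p = holonomy c q := by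
  have cov := (isQuotientCoveringMap_toOrbits (G := G)).isCoveringMap
  obtain ⟨Γ, hΓ⟩ := exists_lift_holonomy c p
  obtain ⟨Λ, hΛ⟩ := exists_lift_holonomy c q
  have h0 : (p.toContinuousMap.HomotopicRel q.toContinuousMap {0, 1}) := hpq
  have h1 := cov.liftPath_apply_one_eq_of_homotopicRel (h0.comp_continuousMap c)
    (rep (c x)) (by simp) (by simp)
  have hΓ' : Γ.toContinuousMap =
      cov.liftPath (c.comp p.toContinuousMap) (rep (c x)) (by simp) :=
    (cov.eq_liftPath_iff' _).2 ⟨funext hΓ, Γ.source⟩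
  have hΛ' : Λ.toContinuousMap =
      cov.liftPath (c.comp q.toContinuousMap) (rep (c x)) (by simp) :=
    (cov.eq_liftPath_iff' _).2 ⟨funext hΛ, Λ.source⟩
  rw [← hΓ', ← hΛ'] at h1
  refine eq_of_smul_eq_smul (rep (c y)) ?_
  have h2 : Γ 1 = Λ 1 := h1
  rw [Γ.target, Λ.target] at h2
  exact h2

end StepSpace

/-! ### Concatenating infinitely many paths -/

theorem exists_continuous_concat {Y : Type*} [TopologicalSpace Y] (γ : ℕ → I → Y)
    (hγ : ∀ j, Continuous (γ j)) (h : ∀ j, γ j 1 = γ (j + 1) 0) :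
    ∃ Γ : C(ℝ, Y), ∀ (j : ℕ) (r : I), Γ (j + r) = γ j r := by
  let Γ : ℝ → Y := fun x => γ ⌊x⌋₊ (Set.projIcc 0 1 zero_le_one (x - ⌊x⌋₊))
  have hΓ (j : ℕ) (r : I) : Γ (j + r) = γ j r := by
    -- At `r = 1` the floor has already jumped to `j + 1`, and the matching condition `h` is what is
    -- needed.
    by_cases hr : r = 1
    · subst hr
      have : ⌊(j : ℝ) + ((1 : I) : ℝ)⌋₊ = j + 1 := by
        rw [Set.Icc.coe_one]
        exact_mod_cast Nat.floor_natCast (R := ℝ) (j + 1)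
      simp only [Γ, this]
      rw [h]
      congr 1
      exact Set.projIcc_of_le_left _ (by simp)
    · have hr1 : (r : ℝ) < 1 := lt_of_le_of_ne r.2.2 fun h => hr (Subtype.ext h)
      have : ⌊(j : ℝ) + (r : ℝ)⌋₊ = j := by
        rw [Nat.floor_eq_iff (add_nonneg j.cast_nonneg r.2.1)]
        exact ⟨le_add_of_nonneg_right r.2.1, by linarith⟩
      simp [Γ, this]
  have hneg (x : ℝ) (hx : x ≤ 0) : Γ x = γ 0 0 := by
    simp only [Γ, Nat.floor_of_nonpos hx]
    congr 1
    exact Set.projIcc_of_le_left _ (by simpa using hx)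
  have hIcc (j : ℕ) : ContinuousOn Γ (Set.Icc j (j + 1)) := by
    have : Continuous fun x : ℝ => γ j (Set.projIcc 0 1 zero_le_one (x - j)) :=
      (hγ j).comp (continuous_projIcc.comp (continuous_id.sub continuous_const))
    refine this.continuousOn.congr fun x hx => ?_
    have hx' : x - j ∈ I := ⟨by linarith [hx.1], by linarith [hx.2]⟩
    have := hΓ j ⟨x - j, hx'⟩
    simp only [Set.projIcc_of_mem _ hx', ← this]
    simp
  have hIic (n : ℕ) : ContinuousOn Γ (Set.Iic n) := by
    induction n with
    | zero =>
      refine (continuousOn_const (c := γ 0 0)).congr fun x hx => hneg x (by simpa using hx)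
    | succ n ih =>
      have := ih.union_of_isClosed (hIcc n) isClosed_Iic isClosed_Icc
      rwa [Set.Iic_union_Icc_eq_Iic (by linarith), ← Nat.cast_succ] at this
  refine ⟨⟨Γ, continuous_iff_continuousAt.2 fun x => ?_⟩, hΓ⟩
  obtain ⟨n, hn⟩ := exists_nat_gt x
  exact (hIic n).continuousAt (Iic_mem_nhds hn)

/-! ### Polar coordinates on the closed disc -/

namespace SignedArrangement

/-- The point of the closed unit disc with polar coordinates `(ρ, 2πθ)`. -/
noncomputable def polar (p : I × I) : Metric.closedBall (0 : ℂ) 1 :=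
  ⟨(p.1 : ℝ) * Circle.exp (2 * Real.pi * p.2), by
    rw [mem_closedBall_zero_iff, norm_mul, Circle.norm_coe, mul_one, Complex.norm_real,
      Real.norm_of_nonneg p.1.2.1]
    exact p.1.2.2⟩

theorem continuous_polar : Continuous polar := by
  unfold polar
  fun_prop

theorem norm_polar (p : I × I) : ‖(polar p : ℂ)‖ = p.1 := by
  rw [polar, norm_mul, Circle.norm_coe, mul_one, Complex.norm_real, Real.norm_of_nonneg p.1.2.1]

theorem polar_one (θ : I) : polar (1, θ) = bdryPoint θ := by
  simp [polar, bdryPoint]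

theorem exists_circle_exp_eq (w : Circle) : ∃ θ : I, Circle.exp (2 * Real.pi * θ) = w := by
  refine ⟨⟨Int.fract (Complex.arg w / (2 * Real.pi)), Int.fract_nonneg _, (Int.fract_lt_one _).le⟩,
    ?_⟩
  refine Eq.trans (Circle.exp_eq_exp.2 ⟨-⌊Complex.arg w / (2 * Real.pi)⌋, ?_⟩) (Circle.exp_arg w)
  simp only [← Int.self_sub_floor]
  push_cast
  field_simp
  ring

theorem exists_bdryPoint_eq (z : Metric.closedBall (0 : ℂ) 1) (hz : ‖(z : ℂ)‖ = 1) :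
    ∃ θ : I, bdryPoint θ = z := by
  obtain ⟨θ, hθ⟩ := exists_circle_exp_eq ⟨z, mem_sphere_zero_iff_norm.2 hz⟩
  exact ⟨θ, Subtype.ext (congrArg (fun w : Circle => (w : ℂ)) hθ)⟩

theorem polar_surjective : Function.Surjective polar := by
  intro z
  by_cases hz : (z : ℂ) = 0
  · exact ⟨(0, 0), Subtype.ext (by simp [polar, hz])⟩
  · have hn : ‖(z : ℂ)‖ ≠ 0 := norm_ne_zero_iff.2 hz
    obtain ⟨θ, hθ⟩ := exists_circle_exp_eq
      ⟨z / ‖(z : ℂ)‖, mem_sphere_zero_iff_norm.2 (by simp [hn])⟩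
    refine ⟨(⟨‖(z : ℂ)‖, norm_nonneg _, mem_closedBall_zero_iff.1 z.2⟩, θ), Subtype.ext ?_⟩
    have hn' : ((‖(z : ℂ)‖ : ℝ) : ℂ) ≠ 0 := by exact_mod_cast hn
    simp only [polar, hθ]
    exact mul_div_cancel₀ _ hn'

theorem isQuotientMap_polar : IsQuotientMap polar :=
  .of_surjective_continuous polar_surjective continuous_polar

/-- Polar coordinates are ambiguous only at the centre and at the angles `0` and `1`; these are the
identifications to check when descending a map to the disc. -/
theorem polar_eq_polar {p q : I × I} (h : polar p = polar q) :
    p.1 = q.1 ∧ (p.1 = 0 ∨ p.2 = q.2 ∨ (p.2 = 0 ∧ q.2 = 1) ∨ (p.2 = 1 ∧ q.2 = 0)) := by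
  have h1 : p.1 = q.1 := Subtype.ext (by rw [← norm_polar, ← norm_polar, h])
  refine ⟨h1, or_iff_not_imp_left.2 fun h0 => ?_⟩
  have h2 : Circle.exp (2 * Real.pi * p.2) = Circle.exp (2 * Real.pi * q.2) := by
    have h3 := congrArg Subtype.val h
    simp only [polar, h1] at h3
    have h4 : ((q.1 : ℝ) : ℂ) ≠ 0 := by
      rw [← h1]
      exact_mod_cast fun h => h0 (Subtype.ext h)
    exact Circle.ext (mul_left_cancel₀ h4 h3)
  obtain ⟨m, hm⟩ := Circle.exp_eq_exp.1 h2
  have hm' : (p.2 : ℝ) = q.2 + m := by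
    have : (2 * Real.pi) * (p.2 : ℝ) = (2 * Real.pi) * (q.2 + m) := by rw [hm]; ring
    exact mul_left_cancel₀ Real.two_pi_pos.ne' this
  have hp := p.2.2
  have hq := q.2.2
  have hm1 : (m : ℝ) ≤ 1 := by linarith [hp.2, hq.1]
  have hm2 : (-1 : ℝ) ≤ m := by linarith [hp.1, hq.2]
  have hm1' : m ≤ 1 := by exact_mod_cast hm1
  have hm2' : -1 ≤ m := by exact_mod_cast hm2
  rcases (by lia : m = -1 ∨ m = 0 ∨ m = 1) with rfl | rfl | rfl
  · refine Or.inr (Or.inl ⟨Subtype.ext ?_, Subtype.ext ?_⟩) <;> push_cast at hm' ⊢ <;>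
      linarith [hp.1, hq.2]
  · exact Or.inl (Subtype.ext (by simpa using hm'))
  · refine Or.inr (Or.inr ⟨Subtype.ext ?_, Subtype.ext ?_⟩) <;> push_cast at hm' ⊢ <;>
      linarith [hp.2, hq.1]

/-- A loop in `StepSpace G` extends to the disc. -/
theorem exists_extension_disc {G : Type*} [Group G] (φ : C(I, StepSpace G)) (h : φ 0 = φ 1) :
    ∃ Ψ : C(Metric.closedBall (0 : ℂ) 1, StepSpace G), ∀ θ : I, Ψ (bdryPoint θ) = φ θ := by
  have hq : IsQuotientMap (⟨polar, continuous_polar⟩ : C(I × I, Metric.closedBall (0 : ℂ) 1)) :=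
    isQuotientMap_polar
  -- The radius is the contraction parameter: the centre goes to `1` and the boundary follows `φ`.
  let Φ : C(I × I, StepSpace G) := ⟨fun p => StepSpace.splice p.1 (φ p.2), by
    have : Continuous fun p : I × I => ((p.1 : ℝ), φ p.2) := by fun_prop
    exact StepSpace.continuous_splice.comp this⟩
  have hΦ : Function.FactorsThrough Φ
      (⟨polar, continuous_polar⟩ : C(I × I, Metric.closedBall (0 : ℂ) 1)) := by
    rintro ⟨ρ, θ⟩ ⟨ρ', θ'⟩ hpq
    obtain ⟨h1, h2⟩ := polar_eq_polar hpq
    simp only at h1 h2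
    subst h1
    rcases h2 with rfl | rfl | ⟨rfl, rfl⟩ | ⟨rfl, rfl⟩ <;> simp [Φ, h]
  refine ⟨hq.lift Φ hΦ, fun θ => ?_⟩
  have := DFunLike.congr_fun (hq.lift_comp Φ hΦ) (1, θ)
  rw [← polar_one]
  refine Eq.trans this ?_
  simp [Φ]

/-! ### The classifying map of a flat labeling -/

variable {L : Type*} (A : SignedArrangement L) {G : Type*} [Group G] (t : L → G)

/-- The lift of the edge labeled by `a`, a path from `1` to the constant function `t a`. -/
noncomputable def edgeLift (a : L) (r : I) : StepSpace G := StepSpace.splice r (t a • 1)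

theorem continuous_edgeLift (a : L) : Continuous (edgeLift t a) := by
  have : Continuous fun r : I => ((r : ℝ), (t a • 1 : StepSpace G)) := by fun_prop
  exact StepSpace.continuous_splice.comp this

@[simp] theorem edgeLift_zero (a : L) : edgeLift t a 0 = 1 := by simp [edgeLift]

@[simp] theorem edgeLift_one (a : L) : edgeLift t a 1 = t a • 1 := by simp [edgeLift]

theorem continuous_orient (u : ℤˣ) : Continuous (orient u) := by
  unfold orient
  split_ifs <;> fun_prop

/-- The product of the first `j` letters of the word of a context. -/
def partialProd (w : List L) (j : ℕ) : G := ((w.take j).map fun a => t a ^ (A.sign a : ℤ)).prod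

theorem partialProd_succ (w : List L) (j : ℕ) (h : j < w.length) :
    A.partialProd t w (j + 1) = A.partialProd t w j * t w[j] ^ (A.sign w[j] : ℤ) := by
  rw [partialProd, partialProd, List.take_add_one, List.getElem?_eq_getElem h,
    List.map_append, List.prod_append]
  simp

/-- The lift of the `j`-th arc of the boundary of a face. -/
noncomputable def arcLift (w : List L) (j : ℕ) (r : I) : StepSpace G :=
  if h : j < w.length then
    -- For an inverse letter the edge is run backwards, so its lift must start, as an edge, at the
    -- end of the arc. Beyond the word the arcs are constant, which permits concatenating an
    -- infinite sequence.
    (if A.sign w[j] = 1 then A.partialProd t w j else A.partialProd t w (j + 1)) •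
      edgeLift t w[j] (orient (A.sign w[j]) r)
  else A.partialProd t w j • 1

theorem continuous_arcLift (w : List L) (j : ℕ) : Continuous (A.arcLift t w j) := by
  have h (g : G) (a : L) : Continuous fun r => g • edgeLift t a (orient (A.sign a) r) :=
    (isometry_smul _ g).continuous.comp ((continuous_edgeLift t a).comp (continuous_orient _))
  unfold arcLift
  split_ifs
  · exact h _ _
  · exact h _ _
  · exact continuous_const

theorem arcLift_zero (w : List L) (j : ℕ) : A.arcLift t w j 0 = A.partialProd t w j • 1 := by
  unfold arcLift
  split_ifs with h h'
  · simp [orient, h']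
  · have h1 : A.sign w[j] = -1 := (Int.units_eq_one_or _).resolve_left h'
    simp [orient, h1, partialProd_succ, h, smul_smul]
  · rfl

theorem arcLift_one (w : List L) (j : ℕ) :
    A.arcLift t w j 1 = A.partialProd t w (j + 1) • 1 := by
  unfold arcLift
  split_ifs with h h'
  · simp [orient, h', partialProd_succ, h, smul_smul]
  · simp [orient, h']
  · simp only [partialProd]
    rw [List.take_of_length_le (by lia), List.take_of_length_le (by lia)]

/-- The lifted boundary runs from `1` to the product of the word, so flatness closes it up and it
extends over the disc. -/
theorem exists_faceLift (w : List L) (hw : (w.map fun a => t a ^ (A.sign a : ℤ)).prod = 1) :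
    ∃ Ψ : C(Metric.closedBall (0 : ℂ) 1, StepSpace G),
      (∀ (j : Fin w.length) (r : I), StepSpace.toOrbits (Ψ (bdryPoint ((j + r) / w.length))) =
        StepSpace.toOrbits (edgeLift t (w.get j) (orient (A.sign (w.get j)) r))) ∧
      (w = [] → ∀ z : Metric.closedBall (0 : ℂ) 1, ‖(z : ℂ)‖ = 1 → Ψ z = 1) := by
  obtain ⟨Γ, hΓ⟩ := exists_continuous_concat (A.arcLift t w) (A.continuous_arcLift t w)
    fun j => by rw [arcLift_zero, arcLift_one]
  have h0 : Γ 0 = 1 := by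
    have := hΓ 0 0
    rw [arcLift_zero] at this
    simpa [partialProd] using this
  have h1 : Γ w.length = 1 := by
    have := hΓ w.length 0
    rw [arcLift_zero] at this
    simpa [partialProd, hw] using this
  obtain ⟨Ψ, hΨ⟩ := exists_extension_disc
    ⟨fun θ : I => Γ (w.length * θ), by fun_prop⟩ (by simp [h0, h1])
  refine ⟨Ψ, fun j r => ?_, ?_⟩
  · have hk : (0 : ℝ) < w.length := by exact_mod_cast j.pos
    have hj : ((j : ℕ) : ℝ) + 1 ≤ w.length := by exact_mod_cast j.2
    have hθ : (((j : ℕ) : ℝ) + r) / w.length ∈ I :=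
      ⟨div_nonneg (add_nonneg (Nat.cast_nonneg _) r.2.1) hk.le,
        (div_le_one hk).2 (by linarith [r.2.2])⟩
    have := hΨ ⟨_, hθ⟩
    simp only [ContinuousMap.coe_mk] at this
    rw [this, mul_div_cancel₀ _ hk.ne', hΓ, arcLift, dif_pos j.2, StepSpace.toOrbits_smul]
    rfl
  · rintro rfl z hz
    obtain ⟨θ, rfl⟩ := exists_bdryPoint_eq z hz
    rw [hΨ]
    simp [h0]

theorem exists_classifying_map
    (ht : ∀ C, ((A.word C).map fun a => t a ^ (A.sign a : ℤ)).prod = 1) :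
    ∃ c : C(A.XSing, StepSpace.Orbits G),
      ∀ a r, c (A.edgeMap a r) = StepSpace.toOrbits (edgeLift t a r) := by
  choose Ψ hΨ hΨ' using fun C => A.exists_faceLift t (A.word C) (ht C)
  let F : A.PreSing → StepSpace G :=
    Sum.elim (fun _ => 1) (Sum.elim (fun x => edgeLift t x.1 x.2) (fun x => Ψ x.1 x.2))
  have hF : Continuous F := by
    refine continuous_const.sumElim (Continuous.sumElim ?_ ?_)
    · exact continuous_sigma fun a => continuous_edgeLift t a
    · exact continuous_sigma fun C => (Ψ C).continuous
  -- `F` itself need not respect the gluing; the discrepancies are translations by `G` and vanish in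
  -- the quotient.
  have hF' : ∀ x y, A.Glue x y → StepSpace.toOrbits (F x) = StepSpace.toOrbits (F y) := by
    rintro _ _ (a | a | ⟨C, j, r⟩ | ⟨C, h, z, hz⟩)
    · simp [F]
    · simp [F, StepSpace.toOrbits_smul]
    · exact hΨ C j r
    · simp [F, hΨ' C h z hz]
  exact ⟨⟨Quot.lift (fun x => StepSpace.toOrbits (F x)) hF',
    continuous_quot_lift hF' (StepSpace.continuous_toOrbits.comp hF)⟩, fun a r => rfl⟩

/-- A flat labeling of the edges has a holonomy, defined for all paths in a space over `XSing`. -/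
theorem exists_holonomy {X : Type*} [TopologicalSpace X] (f : C(X, A.XSing))
    (ht : ∀ C, ((A.word C).map fun a => t a ^ (A.sign a : ℤ)).prod = 1) :
    ∃ F : ∀ {x y : X}, Path x y → G,
      (∀ {x y : X} (p q : Path x y), p.Homotopic q → F p = F q) ∧
      (∀ {x y z : X} (p : Path x y) (q : Path y z), F (p.trans q) = F p * F q) ∧
      ∀ {x y : X} (p : Path x y) (a : L), (∀ r, f (p r) = A.edgeMap a r) → F p = t a := by
  obtain ⟨c, hc⟩ := A.exists_classifying_map t ht
  refine ⟨fun p => StepSpace.holonomy (c.comp f) p,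
    fun p q h => StepSpace.holonomy_eq_of_homotopic _ h,
    fun p q => StepSpace.holonomy_trans _ p q, fun {x y} p a hp => ?_⟩
  have hx : c (f x) = StepSpace.toOrbits 1 := by
    rw [← p.source, hp, hc, edgeLift_zero]
  have hy : c (f y) = StepSpace.toOrbits 1 := by
    rw [← p.target, hp, hc, edgeLift_one, StepSpace.toOrbits_smul]
  have := StepSpace.smul_holonomy_eq_of_lift (c.comp f) p
    ⟨edgeLift t a, continuous_edgeLift t a⟩ (fun r => by simp [hp, hc]) (g := 1) (h := t a)
    (by simp [hx]) (by simp [hy])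
  simpa using this

/-- In a path connected space over `XSing`, a flat labeling is, up to a gauge transformation, a
labeling by elements of a quotient of the fundamental group. -/
theorem exists_gauge {X : Type*} [TopologicalSpace X] [PathConnectedSpace X] (f : C(X, A.XSing))
    (v : X) [Finite (FundamentalGroup X v)]
    (ht : ∀ C, ((A.word C).map fun a => t a ^ (A.sign a : ℤ)).prod = 1) :
    ∃ (H : Subgroup G) (q : X → G), Nat.card H ∣ Nat.card (FundamentalGroup X v) ∧
      Finite H ∧ ∀ {x y : X} (p : Path x y) (a : L), (∀ r, f (p r) = A.edgeMap a r) →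
        q x * t a * (q y)⁻¹ ∈ H := by
  obtain ⟨F, hF, hF_trans, hF_edge⟩ := A.exists_holonomy t f ht
  have hF_refl (x : X) : F (Path.refl x) = 1 := by
    have := hF_trans (Path.refl x) (Path.refl x)
    rw [Path.refl_trans_refl] at this
    simpa using this
  have hF_symm {x y : X} (p : Path x y) : F p.symm = (F p)⁻¹ := by
    rw [eq_inv_iff_mul_eq_one, ← hF_trans, ← hF_refl y]
    exact hF _ _ ⟨(Path.Homotopy.reflSymmTrans p).symm⟩
  -- Multiplication in `FundamentalGroup` concatenates in the reverse order, hence the opposite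
  -- group.
  let Fq : FundamentalGroup X v →* Gᵐᵒᵖ :=
    { toFun := fun γ => Quotient.lift (fun p : Path v v => MulOpposite.op (F p))
        (fun p q h => congrArg _ (hF p q h)) γ.toPath
      map_one' := congrArg MulOpposite.op (hF_refl v)
      map_mul' := by
        rintro ⟨p⟩ ⟨q⟩
        exact congrArg MulOpposite.op (hF_trans q p) }
  have hcard : Nat.card Fq.range.unop = Nat.card Fq.range :=
    Nat.card_congr (Subgroup.equivOp Fq.range.unop)
  refine ⟨Fq.range.unop, fun x => F (PathConnectedSpace.somePath v x), ?_, ?_, ?_⟩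
  · rw [hcard]
    exact Subgroup.card_range_dvd Fq
  · have : Finite Fq.range := Finite.of_surjective _ Fq.rangeRestrict_surjective
    exact Nat.finite_of_card_ne_zero (hcard ▸ Nat.card_pos.ne')
  · intro x y p a hp
    refine ⟨FundamentalGroup.fromPath (Path.Homotopic.Quotient.mk
      (((PathConnectedSpace.somePath v x).trans p).trans
        (PathConnectedSpace.somePath v y).symm)), ?_⟩
    change MulOpposite.op (F _) = _
    rw [hF_trans, hF_trans, hF_symm, hF_edge p a hp]

end SignedArrangement

/-! ### Topological realizations -/

/-- A connected CW complex is path connected. -/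
theorem Topology.CWComplex.pathConnectedSpace (X : Type*) [TopologicalSpace X] [T2Space X]
    [Topology.CWComplex (Set.univ : Set X)] [ConnectedSpace X] : PathConnectedSpace X := by
  obtain ⟨v⟩ := (inferInstance : Nonempty X)
  have hcell (n : ℕ) (i : RelCWComplex.cell (Set.univ : Set X) n) :
      IsPathConnected (RelCWComplex.closedCell n i) :=
    ((convex_closedBall _ _).isPathConnected ⟨0, by simp⟩).image' (RelCWComplex.continuousOn n i)
  -- Each closed cell lies inside the path component or misses it, so the component and its
  -- complement are both closed in the weak topology.
  have key (n : ℕ) (i : RelCWComplex.cell (Set.univ : Set X) n) :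
      RelCWComplex.closedCell n i ⊆ pathComponent v ∨
        Disjoint (pathComponent v) (RelCWComplex.closedCell n i) := by
    rw [or_iff_not_imp_right, Set.not_disjoint_iff]
    rintro ⟨x, hx, hxi⟩ y hy
    exact Joined.trans hx ((hcell n i).joinedIn x hxi y hy).joined
  have hclosed : IsClosed (pathComponent v) := by
    rw [CWComplex.closed (Set.univ : Set X) _ (Set.subset_univ _)]
    intro n i
    rcases key n i with h | h
    · rw [Set.inter_eq_right.2 h]
      exact RelCWComplex.isClosed_closedCell
    · rw [h.inter_eq]
      exact isClosed_empty
  have hopen : IsOpen (pathComponent v) := by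
    rw [← isClosed_compl_iff, CWComplex.closed (Set.univ : Set X) _ (Set.subset_univ _)]
    intro n i
    rcases key n i with h | h
    · rw [(Set.disjoint_compl_left_iff_subset.2 h).inter_eq]
      exact isClosed_empty
    · rw [Set.inter_eq_right.2 h.subset_compl_left]
      exact RelCWComplex.isClosed_closedCell
  have huniv : pathComponent v = Set.univ :=
    IsClopen.eq_univ ⟨hclosed, hopen⟩ ⟨v, Joined.refl v⟩
  have h (x : X) : Joined v x := huniv.ge (Set.mem_univ x)
  exact ⟨⟨v⟩, fun x y => (h x).symm.trans (h y)⟩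

/-! ### Open edges of `XSing` and boundary walks of faces in `X` -/

namespace SignedArrangement

theorem bdryPoint_eq_bdryPoint_iff {s s' : ℝ} :
    bdryPoint s = bdryPoint s' ↔ ∃ m : ℤ, s = s' + m := by
  have : bdryPoint s = bdryPoint s' ↔
      Circle.exp (2 * Real.pi * s) = Circle.exp (2 * Real.pi * s') :=
    Subtype.ext_iff.trans Circle.ext_iff.symm
  rw [this, Circle.exp_eq_exp]
  refine exists_congr fun m => ?_
  rw [← mul_right_inj' Real.two_pi_pos.ne' (b := s)]
  ring_nf

theorem norm_bdryPoint (s : ℝ) : ‖(bdryPoint s : ℂ)‖ = 1 := Circle.norm_coe _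

theorem orient_mem_boundary_iff (u : ℤˣ) (r : I) :
    (orient u r = 0 ∨ orient u r = 1) ↔ (r = 0 ∨ r = 1) := by
  unfold orient
  split_ifs
  · rfl
  · rw [unitInterval.symm_eq_zero, unitInterval.symm_eq_one, or_comm]

theorem arc_param_unique {k : ℕ} (j j' : Fin k) (r r' : I) (hr' : ¬ (r' = 0 ∨ r' = 1))
    (h : bdryPoint (((j : ℕ) + (r : ℝ)) / k) = bdryPoint (((j' : ℕ) + (r' : ℝ)) / k)) :
    j = j' ∧ r = r' := by
  obtain ⟨m, hm⟩ := bdryPoint_eq_bdryPoint_iff.1 h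
  have hk : (0 : ℝ) < k := by exact_mod_cast j.pos
  have hr0 : (0 : ℝ) < r' := lt_of_le_of_ne r'.2.1 fun h => hr' (.inl (Subtype.ext h.symm))
  have hr1 : (r' : ℝ) < 1 := lt_of_le_of_ne r'.2.2 fun h => hr' (.inr (Subtype.ext h))
  have hj : ((j : ℕ) : ℝ) + 1 ≤ k := by exact_mod_cast j.2
  have hj' : ((j' : ℕ) : ℝ) + 1 ≤ k := by exact_mod_cast j'.2
  have hj0 : (0 : ℝ) ≤ (j : ℕ) := Nat.cast_nonneg _
  have hj0' : (0 : ℝ) ≤ (j' : ℕ) := Nat.cast_nonneg _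
  have hm' : ((j : ℕ) : ℝ) + r = (j' : ℕ) + r' + k * m := by
    field_simp at hm
    linarith
  -- Both positions lie in `[0, k]` and the second is strictly inside, so they cannot differ by a
  -- nonzero multiple of `k`.
  have h1 : (m : ℝ) < 1 := by nlinarith [r.2.2]
  have h2 : (-1 : ℝ) < m := by nlinarith [r.2.1]
  have h1' : m < 1 := by exact_mod_cast h1
  have h2' : -1 < m := by exact_mod_cast h2
  obtain rfl : m = 0 := by lia
  simp only [Int.cast_zero, mul_zero, add_zero] at hm'
  have h3 : ((j : ℕ) : ℝ) < ((j' + 1 : ℕ) : ℝ) := by push_cast; linarith [r.2.1]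
  have h4 : ((j' : ℕ) : ℝ) < ((j + 1 : ℕ) : ℝ) := by push_cast; linarith [r.2.2]
  have h3' : (j : ℕ) < j' + 1 := by exact_mod_cast h3
  have h4' : (j' : ℕ) < j + 1 := by exact_mod_cast h4
  obtain rfl : j = j' := Fin.ext (by lia)
  exact ⟨rfl, Subtype.ext (by linarith)⟩

variable {L : Type*} (A : SignedArrangement L)

/-- A point of `PreSing` represents the point with parameter `r` on the edge labeled by `a`. -/
def OnEdge (a : L) (r : I) : A.PreSing → Prop :=
  Sum.elim (fun _ => False) (Sum.elim (fun x => x = ⟨a, r⟩) fun x =>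
    ∃ (j : Fin (A.word x.1).length) (s : I), x.2 = bdryPoint (((j : ℕ) + (s : ℝ)) /
      (A.word x.1).length) ∧ (A.word x.1).get j = a ∧ orient (A.sign a) s = r)

/-- Invariance lets the predicate descend to `XSing`, where it separates interior points of edges
from all other points. -/
theorem onEdge_iff_of_glue (a : L) (r : I) (hr : ¬ (r = 0 ∨ r = 1)) {x y : A.PreSing}
    (h : A.Glue x y) : A.OnEdge a r x ↔ A.OnEdge a r y := by
  rcases h with b | b | ⟨C, j, s⟩ | ⟨C, hC, z, hz⟩
  · simp only [OnEdge, Sum.elim_inl, Sum.elim_inr, iff_false]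
    rintro ⟨⟩
    exact hr (.inl rfl)
  · simp only [OnEdge, Sum.elim_inl, Sum.elim_inr, iff_false]
    rintro ⟨⟩
    exact hr (.inr rfl)
  · simp only [OnEdge, Sum.elim_inl, Sum.elim_inr]
    constructor
    · rintro ⟨j', s', h1, rfl, rfl⟩
      rw [orient_mem_boundary_iff] at hr
      obtain ⟨rfl, rfl⟩ := arc_param_unique j j' s s' hr h1
      rfl
    · rintro ⟨⟩
      exact ⟨j, s, rfl, rfl, rfl⟩
  · simp only [OnEdge, Sum.elim_inl, Sum.elim_inr, iff_false]
    rintro ⟨j, -⟩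
    simpa [hC] using j.2

theorem onEdge_of_mk_eq {a : L} {r : I} (hr : ¬ (r = 0 ∨ r = 1)) {x : A.PreSing}
    (h : (Quot.mk _ x : A.XSing) = A.edgeMap a r) : A.OnEdge a r x := by
  have := congrArg (Quot.lift (A.OnEdge a r)
    fun x y h => propext (A.onEdge_iff_of_glue a r hr h)) h
  exact this.mpr rfl

theorem vertex_ne_edgeMap {a : L} {r : I} (hr : ¬ (r = 0 ∨ r = 1)) :
    A.vertex ≠ A.edgeMap a r :=
  fun h => A.onEdge_of_mk_eq hr h

theorem eq_of_edgeMap_eq {a b : L} {r s : I} (hr : ¬ (r = 0 ∨ r = 1))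
    (h : A.edgeMap b s = A.edgeMap a r) : b = a ∧ s = r := by
  cases A.onEdge_of_mk_eq hr h
  exact ⟨rfl, rfl⟩

theorem norm_eq_one_of_faceMap_eq {a : L} {r : I} (hr : ¬ (r = 0 ∨ r = 1)) {C : A.contexts}
    {z : Metric.closedBall (0 : ℂ) 1} (h : A.faceMap C z = A.edgeMap a r) : ‖(z : ℂ)‖ = 1 := by
  obtain ⟨j, s, h, -⟩ := A.onEdge_of_mk_eq hr h
  simp only at h
  rw [h, norm_bdryPoint]

namespace TopologicalRealization

variable {A} {X : Type*} [TopologicalSpace X] [Topology.CWComplex (Set.univ : Set X)]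
  (R : A.TopologicalRealization X)

open Topology.CWComplex in
-- Uniqueness over interior parameters: the open cell containing `x` cannot have dimension `0` or
-- `2`, and bijectivity on `1`-cells leaves a single edge.
theorem exists_edge_param (a : L) : ∃ φ : C(I, X), (∀ r, R.toSing (φ r) = A.edgeMap a r) ∧
    ∀ x r, ¬ (r = 0 ∨ r = 1) → R.toSing x = A.edgeMap a r → x = φ r := by
  obtain ⟨e, rfl⟩ := R.edgeEquiv.surjective a
  obtain ⟨h, -, hmap⟩ := R.map_edge e
  refine ⟨⟨fun r => map 1 e (h.symm r), ?_⟩, fun r => ?_, fun x r hr hx => ?_⟩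
  · exact (continuousOn 1 e).comp_continuous
      (continuous_subtype_val.comp h.symm.continuous) fun r => (h.symm r).2
  · simp [hmap]
  · have hxu : x ∈ ⋃ (n : ℕ) (j : cell (Set.univ : Set X) n), openCell n j := by
      rw [iUnion_openCell_eq_complex]
      trivial
    simp only [Set.mem_iUnion] at hxu
    obtain ⟨n, i, y, hy, rfl⟩ := hxu
    rcases (by lia : n = 0 ∨ n = 1 ∨ n = 2 ∨ 2 < n) with rfl | rfl | rfl | hn
    · rw [Subsingleton.elim y 0, R.map_vertex] at hx
      exact absurd hx (A.vertex_ne_edgeMap hr)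
    · obtain ⟨h', -, hmap'⟩ := R.map_edge i
      have hi := A.eq_of_edgeMap_eq hr
        ((hmap' ⟨y, Metric.ball_subset_closedBall hy⟩).symm.trans hx)
      obtain rfl := R.edgeEquiv.injective hi.1
      have hy' := A.eq_of_edgeMap_eq hr
        ((hmap ⟨y, Metric.ball_subset_closedBall hy⟩).symm.trans hx)
      simp [← hy'.2]
    · obtain ⟨h', hb', hmap'⟩ := R.map_face i
      have hy' := hmap' ⟨y, Metric.ball_subset_closedBall hy⟩
      have h1 := A.norm_eq_one_of_faceMap_eq hr (hy'.symm.trans hx)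
      have h2 := (hb' ⟨y, Metric.ball_subset_closedBall hy⟩).1 (mem_sphere_zero_iff_norm.2 h1)
      simp only [mem_sphere_zero_iff_norm] at h2
      rw [mem_ball_zero_iff] at hy
      exact absurd h2 hy.ne
    · exact ((R.dim_le_two n hn).false i).elim

open Topology.CWComplex in
theorem exists_face_param (C : A.contexts) : ∃ ψ : C(Metric.closedBall (0 : ℂ) 1, X),
    ∀ z, R.toSing (ψ z) = A.faceMap C z := by
  obtain ⟨f, rfl⟩ := R.faceEquiv.surjective C
  obtain ⟨h, -, hmap⟩ := R.map_face f
  refine ⟨⟨fun z => map 2 f (h.symm z), ?_⟩, fun z => ?_⟩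
  swap
  · exact (hmap (h.symm z)).trans (by rw [h.apply_symm_apply])
  exact (continuousOn 2 f).comp_continuous
    (continuous_subtype_val.comp h.symm.continuous) fun r => (h.symm r).2

theorem _root_.SignedArrangement.continuous_bdryPoint : Continuous bdryPoint := by
  unfold bdryPoint
  fun_prop

/-- The edges of a topological realization have end points, such that the edges of a context form a
closed walk. -/
theorem exists_edge_paths [T2Space X] : ∃ s e : L → X,
    (∀ a, ∃ p : Path (s a) (e a), ∀ r, R.toSing (p r) = A.edgeMap a r) ∧
    ∀ C, ∃ y : ℕ → X, y (A.word C).length = y 0 ∧ ∀ (j : ℕ) (hj : j < (A.word C).length),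
      (A.sign (A.word C)[j] = 1 → s (A.word C)[j] = y j ∧ e (A.word C)[j] = y (j + 1)) ∧
      (A.sign (A.word C)[j] = -1 → e (A.word C)[j] = y j ∧ s (A.word C)[j] = y (j + 1)) := by
  choose φ hφ hφ' using R.exists_edge_param
  refine ⟨fun a => φ a 0, fun a => φ a 1, fun a => ⟨⟨φ a, rfl, rfl⟩, hφ a⟩, fun C => ?_⟩
  obtain ⟨ψ, hψ⟩ := R.exists_face_param C
  -- The attaching map in `X` is recovered from its image in `XSing`: over interior parameters the
  -- point of `X` is unique, and end points follow by density.
  have key (j : Fin (A.word C).length) (r : I) :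
      ψ (bdryPoint (((j : ℕ) + (r : ℝ)) / (A.word C).length)) =
        φ ((A.word C).get j) (orient (A.sign ((A.word C).get j)) r) := by
    have hdense : Dense {r : I | ¬ (r = 0 ∨ r = 1)} :=
      dense_univ.sdiff_finite (Set.toFinite {0, 1} : ({0, 1} : Set I).Finite) |>.mono
        fun r hr => hr.2
    refine congrFun (Continuous.ext_on hdense
      (f := fun r : I => ψ (bdryPoint (((j : ℕ) + (r : ℝ)) / (A.word C).length)))
      (g := fun r : I => φ ((A.word C).get j) (orient (A.sign ((A.word C).get j)) r))
      ?_ ?_ fun r hr => ?_) r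
    · exact ψ.continuous.comp (continuous_bdryPoint.comp (by fun_prop))
    · exact (φ _).continuous.comp (continuous_orient _)
    · refine hφ' _ _ _ (by rwa [orient_mem_boundary_iff]) ?_
      rw [hψ]
      exact Quot.sound (.face C j r)
  refine ⟨fun j => ψ (bdryPoint ((j : ℝ) / (A.word C).length)), ?_, fun j hj => ?_⟩
  · by_cases hk : (A.word C).length = 0
    · simp [hk]
    · refine congrArg ψ (bdryPoint_eq_bdryPoint_iff.2 ⟨1, ?_⟩)
      have : ((A.word C).length : ℝ) ≠ 0 := by exact_mod_cast hk
      simp [this]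
  · have h0 := key ⟨j, hj⟩ 0
    have h1 := key ⟨j, hj⟩ 1
    simp only [Set.Icc.coe_zero, Set.Icc.coe_one, add_zero, List.get_eq_getElem] at h0 h1
    simp only [Nat.cast_add, Nat.cast_one, h0, h1]
    constructor <;> intro h <;> simp [h, orient]

end TopologicalRealization

end SignedArrangement

/-! ### The transfer to a central subgroup -/

/-- If the kernel of `π` is a central copy of `Z`, then some power map is a homomorphism to `Z` on
the preimage of a finite subgroup. -/
theorem exists_pow_hom_of_central {U Q Z : Type*} [Group U] [Group Q] [CommGroup Z] (ι : Z →* U)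
    (hι : Function.Injective ι) (hc : ∀ z u, Commute (ι z) u) (π : U →* Q) (hπ : π.ker = ι.range)
    (H : Subgroup Q) [Finite H] :
    ∃ N : ℕ, N ∣ Nat.card H ∧ ∃ P : H.comap π →* Z, ∀ g, ι (P g) = (g : U) ^ N := by
  let f : H.comap π →* Q := π.comp (H.comap π).subtype
  have hf : f.range ≤ H := by
    rintro _ ⟨g, rfl⟩
    exact g.2
  have : Finite f.range := Finite.of_injective _ (Subgroup.inclusion_injective hf)
  have : f.ker.FiniteIndex := ⟨by rw [Subgroup.index_ker]; exact Nat.card_pos.ne'⟩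
  have hker (k : f.ker) : (k : U) ∈ ι.range := hπ ▸ k.2
  let ϕ : f.ker →* Z := (MonoidHom.ofInjective hι).symm.toMonoidHom.comp
    (((H.comap π).subtype.comp f.ker.subtype).codRestrict ι.range hker)
  have hϕ (k : f.ker) : ι (ϕ k) = k :=
    congrArg Subtype.val ((MonoidHom.ofInjective hι).apply_symm_apply ⟨(k : U), hker k⟩)
  refine ⟨f.ker.index, ?_, ϕ.transfer, fun g => ?_⟩
  · rw [Subgroup.index_ker]
    exact Subgroup.card_dvd_of_le hf
  · rw [MonoidHom.transfer_eq_pow ϕ g, hϕ]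
    · rfl
    -- The transfer is a power map as soon as conjugation fixes powers lying in the kernel; here the
    -- kernel is central.
    · intro k g₀ h
      obtain ⟨z, hz⟩ := hker ⟨_, h⟩
      have h1 : Commute (g₀⁻¹ * g ^ k * g₀) g₀ := by
        refine Subtype.ext ?_
        have := hc z (g₀ : U)
        rw [hz] at this
        exact this
      refine mul_right_cancel (b := g₀) (h1.eq.trans ?_)
      group

theorem Circle.exists_pow_eq {d : ℕ} (hd : d ≠ 0) (w : Circle) : ∃ ν : Circle, ν ^ d = w := by
  refine ⟨Circle.exp (Complex.arg w / d), ?_⟩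
  rw [← Circle.exp_nsmul, nsmul_eq_mul, mul_div_cancel₀ _ (Nat.cast_ne_zero.2 hd), Circle.exp_arg]

theorem AddChar.map_finset_sum_eq_prod {ι A M : Type*} [AddCommMonoid A] [CommMonoid M]
    (ψ : AddChar A M) (s : Finset ι) (f : ι → A) : ψ (∑ i ∈ s, f i) = ∏ i ∈ s, ψ (f i) := by
  classical
  induction s using Finset.induction_on with
  | empty => simp
  | insert i s hi ih => rw [Finset.sum_insert hi, Finset.prod_insert hi, ψ.map_add_eq_mul, ih]

/-- The scalar unitary matrices. -/
noncomputable def scalarUnitary (n : ℕ) : Circle →* Matrix.unitaryGroup (Fin n) ℂ where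
  toFun z := ⟨(z : ℂ) • 1, by
    rw [Matrix.mem_unitaryGroup_iff, star_smul, star_one, smul_mul_smul_comm, mul_one,
      Complex.star_def, Complex.mul_conj, Circle.normSq_coe]
    simp⟩
  map_one' := Subtype.ext (by simp)
  map_mul' z w := Subtype.ext (by simp [smul_smul, mul_comm])

theorem scalarUnitary_injective {n : ℕ} (hn : 1 ≤ n) : Function.Injective (scalarUnitary n) := by
  intro z w h
  have h1 := congrArg Subtype.val h
  have h2 := congrFun (congrFun h1 ⟨0, hn⟩) ⟨0, hn⟩
  simpa [scalarUnitary, Circle.ext_iff] using h2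

theorem scalarUnitary_commute {n : ℕ} (z : Circle) (u : Matrix.unitaryGroup (Fin n) ℂ) :
    Commute (scalarUnitary n z) u :=
  Subtype.ext (by simp [scalarUnitary])

/-! ### From projectively flat labelings to roots of unity -/

namespace SignedArrangement

variable {L : Type*} (A : SignedArrangement L)

/-- Telescoping along a walk. -/
theorem prod_gauge {U X : Type*} [Group U] (q : X → U) (T : L → U) (s e : L → X) (w : List L)
    (y : ℕ → X) (h : ∀ (j : ℕ) (hj : j < w.length),
      (A.sign w[j] = 1 → s w[j] = y j ∧ e w[j] = y (j + 1)) ∧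
      (A.sign w[j] = -1 → e w[j] = y j ∧ s w[j] = y (j + 1))) :
    (w.map fun a => (q (s a) * T a * (q (e a))⁻¹) ^ (A.sign a : ℤ)).prod =
      q (y 0) * (w.map fun a => T a ^ (A.sign a : ℤ)).prod * (q (y w.length))⁻¹ := by
  induction w generalizing y with
  | nil => simp
  | cons a w ih =>
    have h0 := h 0 (by simp)
    have hw := ih (fun j => y (j + 1)) fun j hj => by
      have h1 := h (j + 1) (by simpa using hj)
      rwa [List.getElem_cons_succ] at h1
    rw [List.map_cons, List.prod_cons, hw, List.map_cons, List.prod_cons, List.length_cons]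
    simp only [List.getElem_cons_zero, zero_add] at h0 ⊢
    rcases Int.units_eq_one_or (A.sign a) with ha | ha
    · obtain ⟨h1, h2⟩ := h0.1 ha
      simp [ha, h1, h2, mul_assoc]
    · obtain ⟨h1, h2⟩ := h0.2 ha
      simp [ha, h1, h2, mul_assoc]

theorem prod_map_pow_zpow (κ : L → Circle) (m : ℕ) (w : List L) :
    (w.map fun a => (κ a ^ m) ^ (A.sign a : ℤ)).prod =
      (w.map fun a => κ a ^ (A.sign a : ℤ)).prod ^ m := by
  rw [← powMonoidHom_apply, map_list_prod, List.map_map]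
  congr 2
  funext a
  simp only [Function.comp_apply, powMonoidHom_apply]
  rw [← zpow_natCast (κ a) m, ← zpow_natCast (κ a ^ (A.sign a : ℤ)) m, zpow_comm]

/-- A projectively flat labeling yields a labeling by roots of unity for a multiple of `τ`. -/
theorem TopologicalRealization.exists_root_labeling {X : Type*} [TopologicalSpace X] [T2Space X]
    [Topology.CWComplex (Set.univ : Set X)] (R : A.TopologicalRealization X) (v : X)
    [Finite (FundamentalGroup X v)] {U : Type*} [Group U] (ι : Circle →* U)
    (hι : Function.Injective ι) (hc : ∀ z u, Commute (ι z) u) (T : L → U) (z : A.contexts → Circle)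
    (hT : ∀ C, ((A.word C).map fun a => T a ^ (A.sign a : ℤ)).prod = ι (z C)) {d : ℕ} (hd : d ≠ 0)
    (hz : ∀ C, z C ^ d = 1) :
    ∃ N : ℕ, N ∣ Nat.card (FundamentalGroup X v) ∧ ∃ κ : L → Circle, (∀ a, κ a ^ d = 1) ∧
      ∀ C, ((A.word C).map fun a => κ a ^ (A.sign a : ℤ)).prod =
        z C ^ (N * Nat.card (FundamentalGroup X v)) := by
  have := R.connected
  have := Topology.CWComplex.pathConnectedSpace X
  obtain ⟨s, e, hp, hw⟩ := R.exists_edge_paths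
  choose p hp using hp
  choose y hy0 hy using hw
  have hnormal : ι.range.Normal := ⟨by
    rintro _ ⟨z, rfl⟩ g
    rw [← (hc z g).eq, mul_inv_cancel_right]
    exact ⟨z, rfl⟩⟩
  let π := QuotientGroup.mk' ι.range
  have hπ : π.ker = ι.range := QuotientGroup.ker_mk' _
  obtain ⟨H, q, hH, hfin, hq⟩ := A.exists_gauge (fun a => π (T a)) R.toSing v fun C => by
    simp_rw [← map_zpow]
    rw [← Function.comp_def π, ← List.map_map, ← map_list_prod, hT, ← MonoidHom.mem_ker, hπ]
    exact ⟨z C, rfl⟩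
  obtain ⟨N, hN, P, hP⟩ := exists_pow_hom_of_central ι hι hc π hπ H
  choose Q hQ using fun x => QuotientGroup.mk'_surjective ι.range (q x)
  -- The gauge is lifted from the quotient to `U` vertex by vertex, so it still telescopes along
  -- closed walks.
  let g (a : L) : H.comap π := ⟨Q (s a) * T a * (Q (e a))⁻¹, by
    have := hq (p a) a (hp a)
    rw [← hQ, ← hQ] at this
    simpa [π] using this⟩
  have hg (C : A.contexts) : P (((A.word C).map fun a => g a ^ (A.sign a : ℤ)).prod) = z C ^ N := by
    apply hι
    rw [hP, map_pow]
    congr 1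
    rw [← Subgroup.coe_subtype, map_list_prod, List.map_map, Function.comp_def]
    simp only [map_zpow, Subgroup.coe_subtype, g]
    rw [A.prod_gauge Q T s e (A.word C) (y C) (hy C), hT, hy0, ← (hc _ _).eq, mul_inv_cancel_right]
  have hκ (C : A.contexts) :
      ((A.word C).map fun a => P (g a) ^ (A.sign a : ℤ)).prod = z C ^ N := by
    rw [← hg, map_list_prod, List.map_map]
    simp [Function.comp_def]
  -- Second gauge, now in the circle: `d`-th powers kill the context products since `z C ^ d = 1`.
  obtain ⟨H', q', hH', hfin', hq'⟩ := A.exists_gauge (fun a => P (g a) ^ d) R.toSing v fun C => by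
    rw [prod_map_pow_zpow, hκ, ← pow_mul, mul_comm, pow_mul, hz, one_pow]
  set m := Nat.card (FundamentalGroup X v)
  -- With `ν ^ d = q' ^ m`, the `d`-th power of the corrected label is the `m`-th power of an
  -- element of `H'`, hence `1`.
  choose ν hν using fun x => Circle.exists_pow_eq hd (q' x ^ m)
  refine ⟨N, hN.trans hH, fun a => ν (s a) * P (g a) ^ m * (ν (e a))⁻¹, fun a => ?_, fun C => ?_⟩
  · obtain ⟨k, hk⟩ := hH'
    have h1 : (q' (s a) * P (g a) ^ d * (q' (e a))⁻¹) ^ m = 1 := by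
      have h2 : (⟨_, hq' (p a) a (hp a)⟩ : H') ^ Nat.card H' = 1 := pow_card_eq_one'
      rw [hk, pow_mul]
      exact (congrArg (· ^ k) (congrArg Subtype.val h2)).trans (one_pow k)
    rw [mul_pow, mul_pow, inv_pow, hν, hν, ← h1, mul_pow, mul_pow, inv_pow, ← pow_mul, ← pow_mul,
      mul_comm m d]
  · rw [A.prod_gauge ν (fun a => P (g a) ^ m) s e (A.word C) (y C) (hy C), hy0,
      prod_map_pow_zpow, hκ, mul_right_comm, mul_inv_cancel, one_mul, pow_mul]

theorem omegaPow_eq_toCircle (d : ℕ) [NeZero d] (k : ZMod d) :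
    omegaPow d k = ZMod.toCircle k := by
  rw [omegaPow, ZMod.toCircle_apply, ← Complex.exp_nat_mul]
  congr 1
  ring

theorem exists_toCircle_eq {d : ℕ} [NeZero d] {w : Circle} (hw : w ^ d = 1) :
    ∃ k : ZMod d, ZMod.toCircle k = w := by
  have h : Circle.toUnits w ∈ rootsOfUnity d ℂ := by
    rw [mem_rootsOfUnity, ← map_pow, hw, map_one]
  obtain ⟨i, -, hi⟩ := (Complex.mem_rootsOfUnity d _).1 h
  refine ⟨i, Circle.ext ?_⟩
  rw [ZMod.toCircle_natCast, mul_div_assoc]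
  exact hi

end SignedArrangement

theorem mainTheorem3 {L : Type*} [Finite L] (A : SignedArrangement L) (d : ℕ) (hd : 2 ≤ d)
    {X : Type*} [TopologicalSpace X] [T2Space X] [Topology.CWComplex (Set.univ : Set X)]
    (R : A.TopologicalRealization X) (v : X)
    (hfin : Finite (FundamentalGroup X v))
    (hcop : Nat.Coprime (Nat.card (FundamentalGroup X v)) d)
    (τ : A.contexts → ZMod d) (hτ : A.OperatorRealizable d τ) :
    A.ClassicallyRealizable d τ := by
  classical
  have hd0 : d ≠ 0 := by lia
  have : NeZero d := ⟨hd0⟩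
  obtain ⟨n, hn, T, -, hT⟩ := hτ
  obtain ⟨N, hN, κ, hκ, hκ'⟩ := R.exists_root_labeling A v (scalarUnitary n)
    (scalarUnitary_injective hn) scalarUnitary_commute T (fun C => ZMod.toCircle (τ C))
    (fun C => Subtype.ext ((hT C).trans (by
      rw [SignedArrangement.omegaPow_eq_toCircle]
      rfl))) hd0
    (fun C => by rw [← AddChar.map_nsmul_eq_pow]; simp)
  choose c hc using fun a => SignedArrangement.exists_toCircle_eq (hκ a)
  -- The multiplier `N * |π₁(X)|` of `τ` is invertible modulo `d`; dividing `c` by it yields the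
  -- classical realization.
  let u := ZMod.unitOfCoprime _ ((hcop.coprime_dvd_left hN).mul_left hcop)
  have hsum (C : A.contexts) :
      ((A.word C).map fun a => ((A.sign a : ℤ) : ZMod d) * c a).sum = u * τ C := by
    apply ZMod.injective_toCircle
    rw [ZMod.coe_unitOfCoprime, ← nsmul_eq_mul, AddChar.map_nsmul_eq_pow, ← hκ']
    induction A.word C with
    | nil => simp
    | cons a w ih =>
      rw [List.map_cons, List.sum_cons, AddChar.map_add_eq_mul, ih, List.map_cons, List.prod_cons,
        ← zsmul_eq_mul, AddChar.map_zsmul_eq_zpow, hc]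
  refine ⟨fun a => ((u⁻¹ : (ZMod d)ˣ) : ZMod d) * c a, fun C => ?_⟩
  have hC : C.1 = (A.word C).toFinset := by
    ext a
    rw [List.mem_toFinset, A.mem_word]
  have hterm (a : L) : SignedArrangement.omegaPow d (((A.sign a : ℤ) : ZMod d) *
      (((u⁻¹ : (ZMod d)ˣ) : ZMod d) * c a)) =
        Circle.coeHom (ZMod.toCircle (((u⁻¹ : (ZMod d)ˣ) : ZMod d) *
          (((A.sign a : ℤ) : ZMod d) * c a))) := by
    rw [SignedArrangement.omegaPow_eq_toCircle, mul_left_comm]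
    rfl
  rw [Finset.prod_congr rfl fun a _ => hterm a, ← map_prod, SignedArrangement.omegaPow_eq_toCircle,
    ← AddChar.map_finset_sum_eq_prod, ← Finset.mul_sum, hC, List.sum_toFinset _ (A.word_nodup C),
    hsum, Units.inv_mul_cancel_left]
  rfl
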